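/- Let $k\geq 2$ and $n\geq 2k-3$ be integers. Say that a polynomial $P\in\mathbb{R}[x_1,\dots,x_n]$ has a zero of multiplicity at least $k$ at a point $a\in\mathbb{R}^n$ if all partial derivatives of $P$ of order at most $k-1$ (including $P$ itself) vanish at $a$. Then every polynomial $P\in\mathbb{R}[x_1,\dots,x_n]$ with $P(0,\dots,0)\neq 0$ that has zeroes of multiplicity at least $k$ at all points of $\{0,1\}^n\setminus\{(0,\dots,0)\}$ has (total) degree $\deg P\geq n+2k-3$. Furthermore, there exists such a polynomial $P$ with $\deg P=n+2k-3$. -/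

import Mathlib

/-- The iterated partial derivative `∂/∂x_{i₁} ⋯ ∂/∂x_{iᵣ} P` for a list `[i₁, …, iᵣ]` of indices
(with repetitions allowed); its order is the length `r` of the list. -/
noncomputable def iteratedPDeriv {n : ℕ} (l : List (Fin n)) (P : MvPolynomial (Fin n) ℝ) :
    MvPolynomial (Fin n) ℝ :=
  l.foldr (fun i Q => MvPolynomial.pderiv i Q) P

/-- `P` has a zero of multiplicity at least `k` at `a`: all derivatives of `P` of order at most
`k - 1` (including `P` itself, of order `0`) vanish at `a`. -/
def HasZeroOfMultiplicityAtLeast {n : ℕ} (k : ℕ) (P : MvPolynomial (Fin n) ℝ)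
    (a : Fin n → ℝ) : Prop :=
  ∀ l : List (Fin n), l.length < k → MvPolynomial.eval a (iteratedPDeriv l P) = 0

/-- `P` has zeroes of multiplicity at least `k` at all points of `{0,1}^n \ {(0,…,0)}`. -/
def VanishesOnPuncturedCube {n : ℕ} (k : ℕ) (P : MvPolynomial (Fin n) ℝ) : Prop :=
  ∀ a : Fin n → ℝ, (∀ i, a i = 0 ∨ a i = 1) → a ≠ 0 → HasZeroOfMultiplicityAtLeast k P a

/-! ### Multiplicity and power series substitutions -/

section Multiplicity

open MvPolynomial

variable {n : ℕ}

/-! Lower bound: put `y = x (1 - x) = c_i t` in each coordinate; its roots `r_i` and `1 - r_i` are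
power series in `t` through 0 and 1. Substituting them gives a series divisible by `t ^ k` at every
vertex except 0. Hence all character-weighted vertex sums agree mod `t ^ k`. Symmetry under `r_i ↔ 1
- r_i` makes the sum for `S` equal to `∏ i ∈ S, (1 - 2 r_i)` times a polynomial in `t` of degree at
most `(deg P - |S|) / 2`. If `deg P` is too small, comparing `S` = everything with `S` = everything
but `i` kills one coefficient, which is a polynomial in `c_i`: too many distinct `c_i` are its
roots, yet its leading coefficient is a Catalan number times `P(0)`.

Construction: with `z_i = 1 - 2 x_i` and `σ(y)` a truncation of `√(1 - 4y)`, the product `∏ (z_i +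
σ(y_i))` has the required zeroes. Expanding it and dropping high powers of the `y_i` lowers the
degree to `n + 2k - 3`. -/

theorem iteratedPDeriv_append_singleton (l : List (Fin n)) (i : Fin n)
    (P : MvPolynomial (Fin n) ℝ) :
    iteratedPDeriv (l ++ [i]) P = iteratedPDeriv l (pderiv i P) := by
  simp [iteratedPDeriv]

theorem HasZeroOfMultiplicityAtLeast.pderiv {k : ℕ} {P : MvPolynomial (Fin n) ℝ} {a : Fin n → ℝ}
    (h : HasZeroOfMultiplicityAtLeast (k + 1) P a) (i : Fin n) :
    HasZeroOfMultiplicityAtLeast k (pderiv i P) a := by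
  intro l hl
  rw [← iteratedPDeriv_append_singleton]
  exact h _ (by simpa using hl)

theorem derivative_aeval (f : Fin n → PowerSeries ℝ) (P : MvPolynomial (Fin n) ℝ) :
    PowerSeries.derivative ℝ (aeval f P) =
      ∑ i, aeval f (pderiv i P) * PowerSeries.derivative ℝ (f i) := by
  induction P using MvPolynomial.induction_on with
  | C a => simp
  | add p q hp hq => simp [hp, hq, add_mul, Finset.sum_add_distrib]
  | mul_X p j hp =>
    simp only [map_mul, aeval_X, Derivation.leibniz, hp, pderiv_X, smul_eq_mul, map_add, add_mul,
      Finset.sum_add_distrib, Finset.mul_sum]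
    congr 1
    · rw [Finset.sum_eq_single j]
      · simp
      · intro b _ hb
        simp [hb.symm]
      · simp
    · exact Finset.sum_congr rfl fun i _ => by ring

theorem constantCoeff_aeval (f : Fin n → PowerSeries ℝ) (P : MvPolynomial (Fin n) ℝ) :
    PowerSeries.constantCoeff (aeval f P) =
      eval (fun i => PowerSeries.constantCoeff (f i)) P := by
  induction P using MvPolynomial.induction_on with
  | C a => simp
  | add p q hp hq => simp [hp, hq]
  | mul_X p j hp => simp [hp]

/-- Substituting power series centred at a zero of multiplicity at least `k` gives a power series
of order at least `k`. -/
theorem HasZeroOfMultiplicityAtLeast.X_pow_dvd_aeval {k : ℕ} {P : MvPolynomial (Fin n) ℝ}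
    {f : Fin n → PowerSeries ℝ}
    (h : HasZeroOfMultiplicityAtLeast k P fun i => PowerSeries.constantCoeff (f i)) :
    (PowerSeries.X : PowerSeries ℝ) ^ k ∣ aeval f P := by
  induction k generalizing P with
  | zero => simp
  | succ k ih =>
    have hd : (PowerSeries.X : PowerSeries ℝ) ^ k ∣ PowerSeries.derivative ℝ (aeval f P) := by
      rw [derivative_aeval]
      exact Finset.dvd_sum fun i _ => (ih (h.pderiv i)).mul_right _
    rw [PowerSeries.X_pow_dvd_iff] at hd ⊢
    rintro (_ | m) hm
    · rw [PowerSeries.coeff_zero_eq_constantCoeff_apply, constantCoeff_aeval]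
      exact h [] (by simp)
    · have h1 := hd m (by omega)
      rw [PowerSeries.coeff_derivative] at h1
      exact (mul_eq_zero.mp h1).resolve_right (by positivity)

theorem pderiv_mem_ker_eval_pow {a : Fin n → ℝ} {m : ℕ} {P : MvPolynomial (Fin n) ℝ}
    (hP : P ∈ RingHom.ker (eval a) ^ (m + 1)) (i : Fin n) :
    pderiv i P ∈ RingHom.ker (eval a) ^ m := by
  induction m generalizing P with
  | zero => simp
  | succ m ih =>
    rw [pow_succ] at hP
    induction hP using Submodule.mul_induction_on' with
    | mem_mul_mem p hp q hq =>
      rw [Derivation.leibniz, smul_eq_mul, smul_eq_mul]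
      refine add_mem (Ideal.mul_mem_right _ _ hp) ?_
      rw [pow_succ']
      exact Ideal.mul_mem_mul hq (ih hp)
    | add p _ q _ hp hq => rw [map_add]; exact add_mem hp hq

theorem hasZeroOfMultiplicityAtLeast_of_mem {a : Fin n → ℝ} {k : ℕ}
    {P : MvPolynomial (Fin n) ℝ} (hP : P ∈ RingHom.ker (eval a) ^ k) :
    HasZeroOfMultiplicityAtLeast k P a := by
  have key : ∀ (l : List (Fin n)) (m : ℕ), l.length + m = k →
      iteratedPDeriv l P ∈ RingHom.ker (eval a) ^ m := by
    intro l
    induction l with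
    | nil => rintro m rfl; simpa [iteratedPDeriv] using hP
    | cons i l ih =>
      intro m hm
      exact pderiv_mem_ker_eval_pow (ih (m + 1) (by simp at hm; omega)) i
  intro l hl
  exact Ideal.pow_le_self (by omega) (key l (k - l.length) (by omega))

end Multiplicity

/-! ### The root of `x (1 - x) = c t` vanishing at `t = 0` -/

section CatalanRoot

open PowerSeries

/-- The power series `r` in `t` with `r (1 - r) = c t` and `r(0) = 0`. -/
noncomputable def catalanRoot (c : ℝ) : PowerSeries ℝ :=
  rescale c (X * catalanSeries.map (Nat.castRingHom ℝ))

theorem constantCoeff_catalanRoot (c : ℝ) : constantCoeff (catalanRoot c) = 0 := by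
  rw [← coeff_zero_eq_constantCoeff_apply, catalanRoot, coeff_rescale]
  simp

theorem coeff_succ_catalanRoot (c : ℝ) (m : ℕ) :
    coeff (m + 1) (catalanRoot c) = c ^ (m + 1) * catalan m := by
  rw [catalanRoot, coeff_rescale, coeff_succ_X_mul]
  simp

theorem catalanRoot_mul_one_sub (c : ℝ) :
    catalanRoot c * (1 - catalanRoot c) = C c * X := by
  have h := congrArg (PowerSeries.map (Nat.castRingHom ℝ)) catalanSeries_sq_mul_X_add_one
  simp only [map_add, map_mul, map_pow, map_one, PowerSeries.map_X] at h
  rw [← rescale_X, catalanRoot, ← map_one (rescale c), ← map_sub, ← map_mul]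
  congr 1
  linear_combination -X * h

end CatalanRoot

/-! ### Sign-weighted sums over the substitutions at all vertices -/

section SignedSum

open PowerSeries

/-- The coefficients of `f` vanish in all degrees larger than `m / 2`. -/
def HalfDegreeLE (m : ℤ) (f : PowerSeries ℝ) : Prop :=
  ∀ j : ℕ, m < 2 * j → coeff j f = 0

theorem HalfDegreeLE.mono {m m' : ℤ} {f : PowerSeries ℝ} (hf : HalfDegreeLE m f) (h : m ≤ m') :
    HalfDegreeLE m' f :=
  fun j hj => hf j (by omega)

theorem HalfDegreeLE.add {m : ℤ} {f g : PowerSeries ℝ} (hf : HalfDegreeLE m f)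
    (hg : HalfDegreeLE m g) : HalfDegreeLE m (f + g) := by
  intro j hj
  rw [map_add, hf j hj, hg j hj, add_zero]

theorem HalfDegreeLE.neg {m : ℤ} {f : PowerSeries ℝ} (hf : HalfDegreeLE m f) :
    HalfDegreeLE m (-f) := by
  intro j hj
  rw [map_neg, hf j hj, neg_zero]

theorem HalfDegreeLE.mul {m m' : ℤ} {f g : PowerSeries ℝ} (hf : HalfDegreeLE m f)
    (hg : HalfDegreeLE m' g) : HalfDegreeLE (m + m') (f * g) := by
  intro j hj
  rw [coeff_mul]
  refine Finset.sum_eq_zero fun x hx => ?_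
  replace hx : x.1 + x.2 = j := by simpa using hx
  rcases lt_or_ge m (2 * x.1) with h | h
  · rw [hf _ h, zero_mul]
  · rw [hg x.2 (by omega), mul_zero]

theorem halfDegreeLE_C (a : ℝ) : HalfDegreeLE 0 (C a) := by
  intro j hj
  rw [coeff_C, if_neg (by omega)]

theorem halfDegreeLE_one : HalfDegreeLE 0 (1 : PowerSeries ℝ) := by
  simpa using halfDegreeLE_C 1

theorem halfDegreeLE_zero (m : ℤ) : HalfDegreeLE m 0 := fun j _ => by simp

theorem halfDegreeLE_C_mul_X (a : ℝ) : HalfDegreeLE 2 (C a * X) := by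
  intro j hj
  rw [coeff_C_mul, coeff_X, if_neg (by omega), mul_zero]

theorem HalfDegreeLE.prod {ι : Type*} (s : Finset ι) {m : ι → ℤ} {f : ι → PowerSeries ℝ}
    (h : ∀ i ∈ s, HalfDegreeLE (m i) (f i)) : HalfDegreeLE (∑ i ∈ s, m i) (∏ i ∈ s, f i) := by
  classical
  induction s using Finset.induction_on with
  | empty => simpa using halfDegreeLE_one
  | insert i s hi ih =>
    rw [Finset.sum_insert hi, Finset.prod_insert hi]
    exact (h i (by simp)).mul (ih fun j hj => h j (by simp [hj]))

/-- Power sums of the two roots `r` and `1 - r` of `x (1 - x) = c t`. -/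
theorem halfDegreeLE_pow_add_pow {c : ℝ} {r : PowerSeries ℝ} (hr : r * (1 - r) = C c * X)
    (a : ℕ) : HalfDegreeLE a (r ^ a + (1 - r) ^ a) := by
  induction a using Nat.strong_induction_on with
  | _ a ih =>
    match a with
    | 0 => simpa using halfDegreeLE_one.add halfDegreeLE_one
    | 1 => simpa using halfDegreeLE_one.mono (by norm_num)
    | a + 2 =>
      -- Two-term recurrence for roots with sum 1 and product `c t`; `t` counts as degree 2.
      have e : r ^ (a + 2) + (1 - r) ^ (a + 2) =
          (r ^ (a + 1) + (1 - r) ^ (a + 1)) + -((C c * X) * (r ^ a + (1 - r) ^ a)) := by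
        rw [← hr]; ring
      rw [e]
      exact ((ih (a + 1) (by omega)).mono (by push_cast; omega)).add
        (((halfDegreeLE_C_mul_X c).mul (ih a (by omega))).neg.mono (by push_cast; omega))

/-- The difference is antisymmetric under `r ↔ 1 - r`, so the factor `1 - 2r` splits off and uses up
one degree. -/
theorem exists_pow_sub_pow_eq {c : ℝ} {r : PowerSeries ℝ} (hr : r * (1 - r) = C c * X)
    (a : ℕ) : ∃ w, HalfDegreeLE (a - 1) w ∧ r ^ a - (1 - r) ^ a = (1 - 2 * r) * w := by
  induction a using Nat.strong_induction_on with
  | _ a ih =>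
    match a with
    | 0 => exact ⟨0, halfDegreeLE_zero _, by simp⟩
    | 1 => exact ⟨-1, by simpa using halfDegreeLE_one.neg, by ring⟩
    | a + 2 =>
      obtain ⟨u, hu, hu'⟩ := ih (a + 1) (by omega)
      obtain ⟨v, hv, hv'⟩ := ih a (by omega)
      refine ⟨u + -((C c * X) * v), (hu.mono (by push_cast; omega)).add
        (((halfDegreeLE_C_mul_X c).mul hv).neg.mono (by push_cast; omega)), ?_⟩
      have e : r ^ (a + 2) - (1 - r) ^ (a + 2) =
          (r ^ (a + 1) - (1 - r) ^ (a + 1)) - (C c * X) * (r ^ a - (1 - r) ^ a) := by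
        rw [← hr]; ring
      rw [e, hu', hv']
      ring

variable {n : ℕ}

/-- The value at `b` of the character which is nontrivial precisely for `i ∈ S`. -/
def vertexSign (S : Finset (Fin n)) (i : Fin n) (b : Bool) : ℝ :=
  if i ∈ S ∧ b = true then -1 else 1

/-- The power series roots `r i`, `1 - r i` chosen according to the vertex `ε` of the cube. -/
noncomputable def vertexRoot (r : Fin n → PowerSeries ℝ) (ε : Fin n → Bool) (i : Fin n) :
    PowerSeries ℝ :=
  if ε i = true then 1 - r i else r i

/-- The sum of the substitutions at all vertices of the cube, weighted by a character. -/
noncomputable def signedVertexSum (r : Fin n → PowerSeries ℝ) (S : Finset (Fin n))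
    (P : MvPolynomial (Fin n) ℝ) : PowerSeries ℝ :=
  ∑ ε : Fin n → Bool, C (∏ i, vertexSign S i (ε i)) * MvPolynomial.aeval (vertexRoot r ε) P

theorem signedVertexSum_sum {ι : Type*} (r : Fin n → PowerSeries ℝ) (S : Finset (Fin n))
    (s : Finset ι) (P : ι → MvPolynomial (Fin n) ℝ) :
    signedVertexSum r S (∑ j ∈ s, P j) = ∑ j ∈ s, signedVertexSum r S (P j) := by
  simp only [signedVertexSum, map_sum, Finset.mul_sum]
  exact Finset.sum_comm

theorem signedVertexSum_monomial (r : Fin n → PowerSeries ℝ) (S : Finset (Fin n))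
    (α : Fin n →₀ ℕ) (x : ℝ) :
    signedVertexSum r S (MvPolynomial.monomial α x) =
      C x * ∏ i, (if i ∈ S then r i ^ α i - (1 - r i) ^ α i else r i ^ α i + (1 - r i) ^ α i) := by
  have h : ∀ i, (if i ∈ S then r i ^ α i - (1 - r i) ^ α i else r i ^ α i + (1 - r i) ^ α i) =
      ∑ b : Bool, C (vertexSign S i b) * (if b = true then 1 - r i else r i) ^ α i := by
    intro i
    by_cases hi : i ∈ S <;> simp [hi, vertexSign] <;> ring
  simp only [h]
  rw [Fintype.prod_sum, Finset.mul_sum, signedVertexSum]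
  refine Finset.sum_congr rfl fun ε _ => ?_
  rw [MvPolynomial.aeval_monomial, Finset.prod_mul_distrib, map_prod,
    Finsupp.prod_fintype _ _ (by simp)]
  simp only [vertexRoot, PowerSeries.algebraMap_apply, Algebra.algebraMap_self, RingHom.id_apply]
  ring

/-- On a monomial the sum factors over coordinates into power sums (off `S`) and differences of
powers (on `S`); each difference saves one degree. -/
theorem exists_signedVertexSum_eq {c : Fin n → ℝ} {r : Fin n → PowerSeries ℝ}
    (hr : ∀ i, r i * (1 - r i) = C (c i) * X) (S : Finset (Fin n))
    {P : MvPolynomial (Fin n) ℝ} {d : ℕ} (hP : P.totalDegree ≤ d) :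
    ∃ F, HalfDegreeLE (d - S.card) F ∧
      signedVertexSum r S P = (∏ i ∈ S, (1 - 2 * r i)) * F := by
  classical
  have hmon : ∀ α ∈ P.support, ∃ F, HalfDegreeLE (d - S.card) F ∧
      signedVertexSum r S (MvPolynomial.monomial α (P.coeff α)) =
        (∏ i ∈ S, (1 - 2 * r i)) * F := by
    intro α hα
    choose w hw hw' using fun i => exists_pow_sub_pow_eq (hr i) (α i)
    refine ⟨C (P.coeff α) * ∏ i, (if i ∈ S then w i else r i ^ α i + (1 - r i) ^ α i), ?_, ?_⟩
    · have hf : ∀ i ∈ Finset.univ, HalfDegreeLE ((α i : ℤ) - if i ∈ S then 1 else 0)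
          (if i ∈ S then w i else r i ^ α i + (1 - r i) ^ α i) := by
        intro i _
        by_cases hi : i ∈ S
        · simpa [hi] using hw i
        · simpa [hi] using halfDegreeLE_pow_add_pow (hr i) (α i)
      refine ((halfDegreeLE_C _).mul (HalfDegreeLE.prod _ hf)).mono ?_
      have h1 := (MvPolynomial.le_totalDegree hα).trans hP
      rw [Finsupp.sum_fintype _ _ (by simp)] at h1
      rw [Finset.sum_sub_distrib, zero_add, Finset.sum_ite_mem]
      have h2 : ((∑ i, α i : ℕ) : ℤ) ≤ d := by exact_mod_cast h1
      push_cast at h2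
      simpa using h2
    · rw [signedVertexSum_monomial, mul_left_comm]
      congr 1
      have hS : ∏ i ∈ S, (1 - 2 * r i) = ∏ i, if i ∈ S then 1 - 2 * r i else 1 := by
        rw [Finset.prod_ite_mem, Finset.univ_inter]
      rw [hS, ← Finset.prod_mul_distrib]
      refine Finset.prod_congr rfl fun i _ => ?_
      by_cases hi : i ∈ S
      · simp [hi, hw']
      · simp [hi]
  choose! F hF hF' using hmon
  refine ⟨∑ α ∈ P.support, F α, ?_, ?_⟩
  · intro j hj
    rw [map_sum]
    exact Finset.sum_eq_zero fun α hα => hF α hα j hj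
  · conv_lhs => rw [P.as_sum]
    rw [signedVertexSum_sum, Finset.mul_sum]
    exact Finset.sum_congr rfl hF'

/-- Only the vertex 0 survives mod `X ^ k`, and every character is 1 there, so the residue does not
depend on `S`. -/
theorem X_pow_dvd_signedVertexSum_sub {k : ℕ} {P : MvPolynomial (Fin n) ℝ}
    (hP : VanishesOnPuncturedCube k P) {r : Fin n → PowerSeries ℝ}
    (hr : ∀ i, constantCoeff (r i) = 0) (S : Finset (Fin n)) :
    (X : PowerSeries ℝ) ^ k ∣ signedVertexSum r S P - MvPolynomial.aeval r P := by
  have h0 : C (∏ i, vertexSign S i false) *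
      MvPolynomial.aeval (vertexRoot r fun _ => false) P = MvPolynomial.aeval r P := by
    have : vertexRoot r (fun _ => false) = r := by ext1 i; simp [vertexRoot]
    rw [this]
    simp [vertexSign]
  rw [signedVertexSum, ← Finset.add_sum_erase _ _ (Finset.mem_univ (fun _ : Fin n => false)), h0,
    add_sub_cancel_left]
  refine Finset.dvd_sum fun ε hε => Dvd.dvd.mul_left ?_ _
  have hc : (fun i => constantCoeff (vertexRoot r ε i)) = fun i => if ε i = true then 1 else 0 := by
    ext i
    by_cases h : ε i = true <;> simp [vertexRoot, h, hr]
  refine HasZeroOfMultiplicityAtLeast.X_pow_dvd_aeval (hP _ (fun i => ?_) fun h => ?_)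
  · rw [congrFun hc i]
    by_cases h : ε i = true <;> simp [h]
  · refine (Finset.mem_erase.mp hε).1 (funext fun i => ?_)
    have := congrFun (hc.symm.trans h) i
    by_contra h'
    simp [h'] at this

end SignedSum

/-! ### The lower bound -/

section LowerBound

open PowerSeries

theorem add_le_totalDegree_of_vanishesOnPuncturedCube {k n : ℕ} (hk : 2 ≤ k) (hn : k - 1 ≤ n)
    {P : MvPolynomial (Fin n) ℝ} (h0 : MvPolynomial.eval 0 P ≠ 0)
    (hP : VanishesOnPuncturedCube k P) : n + 2 * k - 3 ≤ P.totalDegree := by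
  by_contra! hdeg
  -- From here the multiplicity is `2 + k`, and the degree is at most `n + 2 * k`.
  obtain ⟨k, rfl⟩ := Nat.exists_eq_add_of_le hk
  set c : Fin n → ℝ := fun i => (i : ℝ) + 1 with hc
  set r : Fin n → PowerSeries ℝ := fun i => catalanRoot (c i) with hr
  have hrc : ∀ i, r i * (1 - r i) = C (c i) * X := fun i => catalanRoot_mul_one_sub _
  have hr0 : ∀ i, constantCoeff (r i) = 0 := fun i => constantCoeff_catalanRoot _
  have hunit : ∀ S : Finset (Fin n), constantCoeff (∏ i ∈ S, (1 - 2 * r i)) = 1 := by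
    intro S
    rw [map_prod]
    exact Finset.prod_eq_one fun i _ => by simp [hr0]
  have hd : P.totalDegree ≤ n + 2 * k := by omega
  obtain ⟨F, hF, hF'⟩ := exists_signedVertexSum_eq hrc Finset.univ hd
  have hFu := X_pow_dvd_signedVertexSum_sub hP hr0 Finset.univ
  have hF0 : constantCoeff F ≠ 0 := by
    have h1 := X_pow_dvd_iff.mp hFu 0 (by omega)
    rw [hF', coeff_zero_eq_constantCoeff_apply, map_sub, map_mul, hunit, constantCoeff_aeval] at h1
    have h2 : (fun i => constantCoeff (r i)) = 0 := funext hr0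
    rw [h2] at h1
    intro h
    rw [h, mul_zero, zero_sub, neg_eq_zero] at h1
    exact h0 h1
  -- Omitting `i` gives `G` the bound `2 * k + 1`, which by parity still excludes degree `k + 1`.
  -- The common factor is a unit and cancels.
  have hcoeff : ∀ i, coeff (k + 1) ((1 - 2 * r i) * F) = 0 := by
    intro i
    obtain ⟨G, hG, hG'⟩ := exists_signedVertexSum_eq hrc (Finset.univ.erase i) hd
    have hGu := X_pow_dvd_signedVertexSum_sub hP hr0 (Finset.univ.erase i)
    have h1 := dvd_sub hFu hGu
    rw [hF', hG', sub_sub_sub_cancel_right, ← Finset.mul_prod_erase _ _ (Finset.mem_univ i),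
      mul_comm (1 - 2 * r i), mul_assoc, ← mul_sub] at h1
    have hu : IsUnit (∏ j ∈ Finset.univ.erase i, (1 - 2 * r j)) := by
      rw [PowerSeries.isUnit_iff_constantCoeff, hunit]
      exact isUnit_one
    have h2 := X_pow_dvd_iff.mp (hu.dvd_mul_left.mp h1) (k + 1) (by omega)
    rw [map_sub, hG (k + 1), sub_zero] at h2
    · exact h2
    · have : (Finset.univ.erase i).card = n - 1 := by simp
      rw [this]
      have := i.pos
      push_cast [Nat.cast_sub this]
      omega
  have hFk : coeff (k + 1) F = 0 := hF _ (by simp)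
  have hsum : ∀ i, ∑ m ∈ Finset.range (k + 1),
      (catalan m : ℝ) * coeff (k - m) F * c i ^ (m + 1) = 0 := by
    intro i
    have h1 := hcoeff i
    have h2 : (1 - 2 * r i) * F = F - C 2 * (r i * F) := by
      rw [show (C 2 : PowerSeries ℝ) = 2 from map_ofNat _ 2]; ring
    rw [h2, map_sub, hFk, coeff_C_mul, coeff_mul,
      Finset.Nat.sum_antidiagonal_eq_sum_range_succ
        (fun a b => coeff a (r i) * coeff b F), Finset.sum_range_succ'] at h1
    simp only [coeff_zero_eq_constantCoeff_apply, hr0, zero_mul, add_zero, zero_sub, neg_eq_zero,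
      mul_eq_zero, OfNat.ofNat_ne_zero, false_or] at h1
    rw [← h1]
    refine Finset.sum_congr rfl fun m _ => ?_
    rw [hr, coeff_succ_catalanRoot, Nat.add_sub_add_right]
    ring
  -- The relation `hsum` divided by `c i`: degree at most `k`, with `n ≥ k + 1` distinct roots.
  set p : Polynomial ℝ := ∑ m ∈ Finset.range (k + 1),
    Polynomial.monomial m ((catalan m : ℝ) * coeff (k - m) F) with hp
  have hpc : p.coeff k = (catalan k : ℝ) * constantCoeff F := by
    rw [hp, Polynomial.finsetSum_coeff, Finset.sum_eq_single k]
    · simp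
    · intro b _ hb
      rw [Polynomial.coeff_monomial, if_neg hb]
    · simp
  have hcat : (catalan k : ℝ) ≠ 0 := by
    have h := Nat.centralBinom_pos k
    rw [← succ_mul_catalan_eq_centralBinom] at h
    exact_mod_cast (Nat.pos_of_mul_pos_left h).ne'
  have hpd : p.natDegree ≤ k := by
    refine Polynomial.natDegree_sum_le_of_forall_le _ _ fun m hm => ?_
    exact (Polynomial.natDegree_monomial_le _).trans (by simpa [Nat.lt_succ_iff] using hm)
  have hpz : p = 0 := by
    refine Polynomial.eq_zero_of_natDegree_lt_card_of_eval_eq_zero p (f := c) ?_ ?_ ?_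
    · intro i j hij
      simp only [hc, add_left_inj, Nat.cast_inj] at hij
      exact Fin.ext hij
    · intro i
      have hci : c i ≠ 0 := by positivity
      refine (mul_eq_zero.mp (?_ : c i * p.eval (c i) = 0)).resolve_left hci
      rw [← hsum i, hp, Polynomial.eval_finsetSum, Finset.mul_sum]
      refine Finset.sum_congr rfl fun m _ => ?_
      rw [Polynomial.eval_monomial]
      ring
    · rw [Fintype.card_fin]
      omega
  rw [hpz, Polynomial.coeff_zero] at hpc
  exact mul_ne_zero hcat hF0 hpc.symm

end LowerBound

/-! ### The construction -/

section Construction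

open MvPolynomial

variable {n : ℕ}

/-- `1 - 2r` with `r (1 - r) = X` is a square root of `1 - 4X`; truncate it. -/
theorem exists_polynomial_sq_sub (k : ℕ) :
    ∃ σ : Polynomial ℝ, (0 < k → σ.eval 0 = 1) ∧
      Polynomial.X ^ k ∣ σ ^ 2 - (1 - 4 * Polynomial.X) := by
  set s : PowerSeries ℝ := 1 - 2 * catalanRoot 1 with hs
  have hs2 : s * s = ((1 - 4 * Polynomial.X : Polynomial ℝ) : PowerSeries ℝ) := by
    have h := catalanRoot_mul_one_sub 1
    simp only [map_one, one_mul] at h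
    have h4 : ((4 : Polynomial ℝ) : PowerSeries ℝ) = 4 :=
      map_ofNat (Polynomial.coeToPowerSeries.ringHom (R := ℝ)) 4
    rw [Polynomial.coe_sub, Polynomial.coe_mul, Polynomial.coe_one, Polynomial.coe_X, h4, hs]
    linear_combination (-4 : PowerSeries ℝ) * h
  refine ⟨PowerSeries.trunc k s, fun hk => ?_, ?_⟩
  · rw [← Polynomial.coeff_zero_eq_eval_zero, PowerSeries.coeff_trunc, if_pos hk,
      PowerSeries.coeff_zero_eq_constantCoeff_apply, hs]
    simp [constantCoeff_catalanRoot]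
  · rw [Polynomial.X_pow_dvd_iff]
    intro d hd
    have h := PowerSeries.coeff_mul_eq_coeff_trunc_mul_trunc s s hd
    rw [hs2, ← Polynomial.coe_mul, Polynomial.coeff_coe, Polynomial.coeff_coe] at h
    rw [Polynomial.coeff_sub, sq, h, sub_self]

theorem X_mul_one_sub_X_mem_ker_eval {a : Fin n → ℝ} (ha : ∀ i, a i = 0 ∨ a i = 1) (i : Fin n) :
    (X i * (1 - X i) : MvPolynomial (Fin n) ℝ) ∈ RingHom.ker (eval a) := by
  rw [RingHom.mem_ker]
  rcases ha i with h | h <;> simp [h]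

theorem totalDegree_X_mul_one_sub_X_le (i : Fin n) :
    (X i * (1 - X i) : MvPolynomial (Fin n) ℝ).totalDegree ≤ 2 := by
  refine (totalDegree_mul _ _).trans ?_
  have h1 : (X i : MvPolynomial (Fin n) ℝ).totalDegree = 1 := totalDegree_X i
  have h2 : (1 - X i : MvPolynomial (Fin n) ℝ).totalDegree ≤ 1 :=
    (totalDegree_sub _ _).trans (by simp [h1])
  omega

/-- Modulo `k`-th powers of the vanishing ideals of the vertices, every polynomial in the
`x_i (1 - x_i)` agrees with one of degree at most `2 (k - 1)`. -/
theorem exists_totalDegree_le_sub_mem {k : ℕ} (Q : MvPolynomial (Fin n) ℝ) :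
    ∃ T : MvPolynomial (Fin n) ℝ, T.totalDegree ≤ 2 * (k - 1) ∧
      ∀ a : Fin n → ℝ, (∀ i, a i = 0 ∨ a i = 1) →
        aeval (fun i => (X i * (1 - X i) : MvPolynomial (Fin n) ℝ)) Q - T ∈
          RingHom.ker (eval a) ^ k := by
  induction Q using MvPolynomial.induction_on' with
  | monomial α x =>
    have hα : aeval (fun i => (X i * (1 - X i) : MvPolynomial (Fin n) ℝ)) (monomial α x) =
        C x * ∏ i, (X i * (1 - X i)) ^ α i := by
      rw [aeval_monomial, Finsupp.prod_fintype _ _ (by simp), algebraMap_eq]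
    rcases lt_or_ge (∑ i, α i) k with h | h
    · refine ⟨C x * ∏ i, (X i * (1 - X i)) ^ α i, ?_, fun a _ => by
        rw [hα, sub_self]; exact zero_mem _⟩
      refine (totalDegree_mul _ _).trans ?_
      rw [totalDegree_C, zero_add]
      refine (totalDegree_finsetProd _ _).trans ?_
      calc _ ≤ ∑ i, α i * 2 := Finset.sum_le_sum fun i _ => (totalDegree_pow _ _).trans
            (Nat.mul_le_mul_left _ (totalDegree_X_mul_one_sub_X_le i))
        _ ≤ 2 * (k - 1) := by rw [← Finset.sum_mul]; omega
    · refine ⟨0, by simp, fun a ha => ?_⟩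
      rw [hα, sub_zero]
      refine Ideal.mul_mem_left _ _ (Ideal.pow_le_pow_right h ?_)
      rw [← Finset.prod_pow_eq_pow_sum]
      exact Ideal.prod_mem_prod fun i _ =>
        Ideal.pow_mem_pow (X_mul_one_sub_X_mem_ker_eval ha i) _
  | add p q hp hq =>
    obtain ⟨T, hT, hT'⟩ := hp
    obtain ⟨U, hU, hU'⟩ := hq
    refine ⟨T + U, (totalDegree_add _ _).trans (max_le hT hU), fun a ha => ?_⟩
    rw [map_add, add_sub_add_comm]
    exact add_mem (hT' a ha) (hU' a ha)

/-- A polynomial nonzero at `a` is a unit modulo powers of the maximal ideal at `a`. -/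
theorem mem_ker_eval_pow_of_mul_mem {a : Fin n → ℝ} {k : ℕ} {p q : MvPolynomial (Fin n) ℝ}
    (h : p * q ∈ RingHom.ker (eval a) ^ k) (hq : eval a q ≠ 0) :
    p ∈ RingHom.ker (eval a) ^ k := by
  have hmem : C (eval a q) - q ∈ RingHom.ker (eval a) := by simp [RingHom.mem_ker]
  have hd : q ∣ C (eval a q) ^ k - (C (eval a q) - q) ^ k := by
    have h := sub_dvd_pow_sub_pow (C (eval a q)) (C (eval a q) - q) k
    rwa [sub_sub_cancel] at h
  obtain ⟨u, hu⟩ := hd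
  have h1 : C (eval a q ^ k) * p ∈ RingHom.ker (eval a) ^ k := by
    have e : C (eval a q ^ k) * p = u * (p * q) + p * (C (eval a q) - q) ^ k := by
      rw [map_pow]; linear_combination p * hu
    rw [e]
    exact add_mem (Ideal.mul_mem_left _ _ h) (Ideal.mul_mem_left _ _ (Ideal.pow_mem_pow hmem _))
  have h2 := Ideal.mul_mem_left _ (C ((eval a q ^ k)⁻¹)) h1
  rwa [← mul_assoc, ← map_mul, inv_mul_cancel₀ (pow_ne_zero _ hq), map_one, one_mul] at h2

theorem exists_vanishesOnPuncturedCube {k : ℕ} (hk : 2 ≤ k) (n : ℕ) :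
    ∃ P : MvPolynomial (Fin n) ℝ, eval 0 P ≠ 0 ∧ VanishesOnPuncturedCube k P ∧
      P.totalDegree ≤ n + 2 * k - 3 := by
  classical
  obtain ⟨σ, hσ0, hσ⟩ := exists_polynomial_sq_sub k
  replace hσ0 := hσ0 (by omega)
  set y : Fin n → MvPolynomial (Fin n) ℝ := fun i => X i * (1 - X i) with hy
  set z : Fin n → MvPolynomial (Fin n) ℝ := fun i => 1 - 2 * X i with hz
  have hT : ∀ U : Finset (Fin n), ∃ T : MvPolynomial (Fin n) ℝ,
      -- For nonempty `U` at most `n - 1` factors `z i` remain, whence `n - 1 + 2 * (k - 1)`; the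
      -- empty product needs no truncation.
      T.totalDegree ≤ (if U = ∅ then 0 else 2 * (k - 1)) ∧
      ∀ a : Fin n → ℝ, (∀ i, a i = 0 ∨ a i = 1) →
        ∏ i ∈ U, Polynomial.aeval (y i) σ - T ∈ RingHom.ker (eval a) ^ k := by
    intro U
    by_cases hU : U = ∅
    · exact ⟨1, by simp [hU], by simp [hU]⟩
    · obtain ⟨T, hT, hT'⟩ := exists_totalDegree_le_sub_mem (k := k)
        (∏ i ∈ U, Polynomial.aeval (X i : MvPolynomial (Fin n) ℝ) σ)
      refine ⟨T, by simpa [hU] using hT, fun a ha => ?_⟩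
      have := hT' a ha
      simp only [map_prod, ← Polynomial.aeval_algHom_apply, aeval_X] at this
      exact this
  choose T hT hT' using hT
  set P : MvPolynomial (Fin n) ℝ :=
    ∑ S ∈ (Finset.univ : Finset (Fin n)).powerset, (∏ i ∈ S, z i) * T (Finset.univ \ S) with hP
  have hcongr : ∀ a : Fin n → ℝ, (∀ i, a i = 0 ∨ a i = 1) →
      ∏ i, (z i + Polynomial.aeval (y i) σ) - P ∈ RingHom.ker (eval a) ^ k := by
    intro a ha
    rw [Finset.prod_add, hP, ← Finset.sum_sub_distrib]
    refine sum_mem fun S _ => ?_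
    rw [← mul_sub]
    exact Ideal.mul_mem_left _ _ (hT' _ a ha)
  have heval : ∀ (a : Fin n → ℝ), (∀ i, a i = 0 ∨ a i = 1) → ∀ i,
      eval a (Polynomial.aeval (y i) σ) = 1 := by
    intro a ha i
    have h1 : eval a (Polynomial.aeval (y i) σ) = σ.eval (eval a (y i)) := by
      have := Polynomial.aeval_algHom_apply (MvPolynomial.aeval a : _ →ₐ[ℝ] ℝ) (y i) σ
      simpa [MvPolynomial.aeval_eq_eval, Polynomial.aeval_def] using this.symm
    rw [h1, (RingHom.mem_ker).mp (X_mul_one_sub_X_mem_ker_eval ha i), hσ0]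
  refine ⟨P, ?_, fun a ha ha0 => ?_, ?_⟩
  · have h := Ideal.pow_le_self (by omega) (hcongr 0 fun i => Or.inl rfl)
    rw [RingHom.mem_ker, map_sub, sub_eq_zero, map_prod] at h
    rw [← h]
    refine Finset.prod_ne_zero_iff.mpr fun i _ => ?_
    rw [map_add, heval 0 (fun i => Or.inl rfl) i]
    norm_num [hz]
  · refine hasZeroOfMultiplicityAtLeast_of_mem ?_
    rw [← sub_sub_cancel (∏ i, (z i + Polynomial.aeval (y i) σ)) P]
    refine sub_mem ?_ (hcongr a ha)
    obtain ⟨i, hi⟩ := Function.ne_iff.mp ha0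
    replace hi : a i = 1 := (ha i).resolve_left hi
    rw [← Finset.mul_prod_erase _ _ (Finset.mem_univ i)]
    -- Since `z i ^ 2 = 1 - 4 * y i`, the product of `σ + z` and `σ - z` is divisible by `y i ^ k`;
    -- where `a i = 1`, `σ - z` takes the value 2.
    refine Ideal.mul_mem_right _ _
      (mem_ker_eval_pow_of_mul_mem (q := Polynomial.aeval (y i) σ - z i) ?_ ?_)
    · obtain ⟨τ, hτ⟩ := hσ
      have h := congrArg (Polynomial.aeval (y i)) hτ
      simp only [map_sub, map_mul, map_pow, map_one, map_ofNat, Polynomial.aeval_X] at h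
      have e : (z i + Polynomial.aeval (y i) σ) * (Polynomial.aeval (y i) σ - z i) =
          y i ^ k * Polynomial.aeval (y i) τ := by
        rw [← h]
        simp only [hy, hz]
        ring
      rw [e]
      exact Ideal.mul_mem_right _ _ (Ideal.pow_mem_pow (X_mul_one_sub_X_mem_ker_eval ha i) _)
    · rw [map_sub, heval a ha i]
      norm_num [hz, hi]
  · refine totalDegree_finsetSum_le fun S _ => (totalDegree_mul _ _).trans ?_
    have hz1 : ∀ i, (z i).totalDegree ≤ 1 := fun i =>
      (totalDegree_sub _ _).trans (max_le (by simp) ((totalDegree_mul _ _).trans (by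
        rw [totalDegree_X, show (2 : MvPolynomial (Fin n) ℝ) = C 2 from (map_ofNat C 2).symm,
          totalDegree_C])))
    have h1 : (∏ i ∈ S, z i).totalDegree ≤ S.card :=
      (totalDegree_finsetProd _ _).trans
        ((Finset.sum_le_sum fun i _ => hz1 i).trans (by simp))
    have h2 := hT (Finset.univ \ S)
    have h3 := Finset.card_sdiff_add_card_eq_card (Finset.subset_univ S)
    rw [Finset.card_univ, Fintype.card_fin] at h3
    split_ifs at h2 with hS
    · omega
    · have := Finset.card_pos.mpr (Finset.nonempty_iff_ne_empty.mpr hS)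
      omega

end Construction

theorem theorem1 (k n : ℕ) (hk : 2 ≤ k) (hn : 2 * k - 3 ≤ n) :
    (∀ P : MvPolynomial (Fin n) ℝ, MvPolynomial.eval 0 P ≠ 0 → VanishesOnPuncturedCube k P →
      n + 2 * k - 3 ≤ P.totalDegree) ∧
    (∃ P : MvPolynomial (Fin n) ℝ, MvPolynomial.eval 0 P ≠ 0 ∧ VanishesOnPuncturedCube k P ∧
      P.totalDegree = n + 2 * k - 3) := by
  have lower : ∀ P : MvPolynomial (Fin n) ℝ, MvPolynomial.eval 0 P ≠ 0 →
      VanishesOnPuncturedCube k P → n + 2 * k - 3 ≤ P.totalDegree :=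
    fun P h0 hP => add_le_totalDegree_of_vanishesOnPuncturedCube hk (by omega) h0 hP
  obtain ⟨P, h0, hP, hd⟩ := exists_vanishesOnPuncturedCube hk n
  exact ⟨lower, P, h0, hP, hd.antisymm (lower P h0 hP)⟩
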